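/- For a finite simple graph $G$ on $n$ vertices with adjacency matrix $A(G)$, let $\pi(G,x)=\operatorname{per}(xI-A(G))$ be its permanental polynomial, let $\mu_1,\dots,\mu_n\in\mathbb{C}$ be the roots of $\pi(G,x)$ listed with multiplicity, and let $E_{\mathrm{per}}(G)=\sum_{i=1}^n|\mu_i|$ be its permanental energy. Write $K_{1,n-1}$ for the star and $P_n$ for the path on $n$ vertices. Then for every $n\ge 1$ and every tree $T$ on $n$ vertices, $$E_{\mathrm{per}}(K_{1,n-1})\le E_{\mathrm{per}}(T)\le E_{\mathrm{per}}(P_n),$$ with equality on the left if and only if $T\cong K_{1,n-1}$, and equality on the right if and only if $T\cong P_n$. -/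

import Mathlib

namespace SimpleGraph

open Classical in
/-- The permanental polynomial `per (x I - A(G))` of a finite simple graph `G`, as a polynomial
with complex coefficients. Here `Matrix.charmatrix A` is the matrix `x I - A`. -/
noncomputable def permanentalPoly {V : Type*} [Fintype V] (G : SimpleGraph V) : Polynomial ℂ :=
  (Matrix.charmatrix (G.adjMatrix ℂ)).permanent

/-- The permanental energy of `G`: the sum of the moduli of the complex roots of the permanental
polynomial, counted with multiplicity. -/
noncomputable def permanentalEnergy {V : Type*} [Fintype V] (G : SimpleGraph V) : ℝ :=
  (G.permanentalPoly.roots.map fun μ => ‖μ‖).sum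

end SimpleGraph

/-! In a forest only involutions contribute to the permanent, so multiplying off-diagonal entries by
`i` cancels the signs: `per(x - A) = det(x - iA)` (`IsAcyclic.permanent_eq_det`). The roots are thus
`iλ` with `λ` the eigenvalues of `A`, and the energy is `∑ |λ|`.

The same twist gives `M(t) = per(1 + tA) = ∏ (1 + itλ)`. This is real, so `M(t)² = ∏ (1 + t²λ²)`.
Since `∫ log(1 + (tx)²)/t² dt = c|x|` over `t > 0`, the integral of `log M(t)/t²` is `c/2` times the
energy, and forests can be compared through `M(t)` pointwise.

For a leaf `v` at `u`, `M(G) = M(G-v) + t² M(G-v-u)` (`IsAcyclic.matchingSum_leaf`). Induction makes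
the path maximal and the star minimal among trees. Equal energies force equal `M` at some `t > 0`,
and equality at one such `t` already determines the tree. -/

/-! ### Permanents as determinants on forests -/

namespace Equiv.Perm

/-- An involution is a product of `k` disjoint transpositions: its sign is `(-1)^k`, its support has
size `2k`, and `ζ^(2k) = (-1)^k`. -/
theorem sign_mul_pow_card_support_of_sq_eq_one {α R : Type*} [Fintype α] [DecidableEq α]
    [CommRing R] {ζ : R} (hζ : ζ ^ 2 = -1) {σ : Perm α} (hσ : σ ^ 2 = 1) :
    ((sign σ : ℤ) : R) * ζ ^ σ.support.card = 1 := by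
  have h := cycleType_of_pow_prime_eq_one (p := 2) hσ
  have hs := σ.sum_cycleType
  rw [h, Multiset.sum_replicate, smul_eq_mul] at hs
  rw [sign_of_cycleType, sum_cycleType, ← hs]
  push_cast
  rw [mul_comm _ 2, pow_mul, hζ, pow_add, pow_mul, ← mul_pow, ← mul_pow]
  simp

end Equiv.Perm

namespace SimpleGraph

variable {V : Type*} {G : SimpleGraph V}

/-- A forest extends to a spanning tree of the complete graph; a leaf of that tree has at most one
neighbour in the forest. -/
theorem IsAcyclic.exists_isolated_or_leaf [Finite V] [Nonempty V] (hG : G.IsAcyclic) :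
    ∃ v, (∀ w, ¬ G.Adj v w) ∨ ∃ u, ∀ w, G.Adj v w ↔ w = u := by
  classical
  have := Fintype.ofFinite V
  obtain ⟨T, hGT, -, hT⟩ := (connected_top (V := V)).exists_isTree_le_of_le_of_isAcyclic le_top hG
  cases subsingleton_or_nontrivial V with
  | inl h => exact ⟨Classical.arbitrary V, .inl fun w hw => hw.ne (Subsingleton.elim _ _)⟩
  | inr h =>
    obtain ⟨v, hv⟩ := hT.exists_vert_degree_one_of_nontrivial
    obtain ⟨u, -, hu⟩ := degree_eq_one_iff_existsUnique_adj.mp hv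
    refine ⟨v, ?_⟩
    by_cases h : G.Adj v u
    · exact .inr ⟨u, fun w => ⟨fun hw => hu w (hGT hw), fun hw => hw ▸ h⟩⟩
    · exact .inl fun w hw => h (hu w (hGT hw) ▸ hw)

/-- On the points moved by `σ²`, the vertices `σ y` and `σ⁻¹ y` are two distinct neighbours of `y`,
so the forest induced there would have no vertex of degree at most one. -/
theorem IsAcyclic.perm_sq_eq_one [Finite V] (hG : G.IsAcyclic) (σ : Equiv.Perm V)
    (hσ : ∀ v, σ v = v ∨ G.Adj (σ v) v) : σ ^ 2 = 1 := by
  by_contra hne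
  obtain ⟨x, hx⟩ : ∃ x, σ (σ x) ≠ x := by
    by_contra! h
    exact hne (Equiv.ext fun x => by simpa [sq] using h x)
  let S : Set V := {y | σ (σ y) ≠ y}
  have : Nonempty S := ⟨⟨x, hx⟩⟩
  have hadj : ∀ y ∈ S, G.Adj y (σ y) := fun y hy =>
    ((hσ y).resolve_left fun h => hy (by rw [h, h])).symm
  have hfwd : ∀ y ∈ S, σ y ∈ S := fun y hy h => hy (σ.injective h)
  have hbwd : ∀ y ∈ S, σ.symm y ∈ S := fun y hy h => hy (by
    rw [σ.apply_symm_apply] at h; rw [h, σ.apply_symm_apply])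
  obtain ⟨⟨v, hv⟩, h⟩ := (hG.induce S).exists_isolated_or_leaf
  have h1 : (G.induce S).Adj ⟨v, hv⟩ ⟨σ v, hfwd v hv⟩ := hadj v hv
  have h2 : (G.induce S).Adj ⟨v, hv⟩ ⟨σ.symm v, hbwd v hv⟩ := by
    have := (hadj _ (hbwd v hv)).symm
    rwa [σ.apply_symm_apply] at this
  rcases h with h | ⟨u, h⟩
  · exact h _ h1
  · have := congrArg Subtype.val (((h _).1 h1).trans ((h _).1 h2).symm)
    dsimp only at this
    exact hv (by rw [this, σ.apply_symm_apply])

/-- On an acyclic graph, twisting the off-diagonal entries by a square root of `-1` turns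
permanents into determinants. -/
theorem IsAcyclic.permanent_eq_det [Fintype V] [DecidableEq V] {R : Type*} [CommRing R]
    (hG : G.IsAcyclic) {ζ : R} (hζ : ζ ^ 2 = -1) {P Q : Matrix V V R}
    (hdiag : ∀ v, Q v v = P v v) (hadj : ∀ v w, v ≠ w → Q v w = ζ * P v w)
    (hP : ∀ v w, v ≠ w → ¬ G.Adj v w → P v w = 0) :
    P.permanent = Q.det := by
  rw [Matrix.permanent, Matrix.det_apply']
  refine Finset.sum_congr rfl fun σ _ => ?_
  have hQ : ∏ i, Q (σ i) i = ζ ^ σ.support.card * ∏ i, P (σ i) i := by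
    have h : ζ ^ σ.support.card = ∏ i, if i ∈ σ.support then ζ else 1 := by
      rw [Fintype.prod_ite_mem, Finset.prod_const]
    rw [h, ← Finset.prod_mul_distrib]
    refine Finset.prod_congr rfl fun i _ => ?_
    by_cases h : σ i = i
    · simp [h, hdiag]
    · simp [h, hadj]
  rw [hQ, ← mul_assoc]
  by_cases h : ∀ v, σ v = v ∨ G.Adj (σ v) v
  · rw [Equiv.Perm.sign_mul_pow_card_support_of_sq_eq_one hζ (hG.perm_sq_eq_one σ h), one_mul]
  · push Not at h
    obtain ⟨v, hv, hv'⟩ := h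
    have h0 : ∏ i, P (σ i) i = 0 := Finset.prod_eq_zero (Finset.mem_univ v) (hP _ _ hv hv')
    rw [h0, mul_zero]

end SimpleGraph

/-! ### Expanding determinants at a leaf -/

namespace Matrix

variable {V R : Type*} [Fintype V] [DecidableEq V] [CommRing R]

theorem det_eq_det_submatrix_compl_singleton {M : Matrix V V R} {v : V} (hv : M v v = 1)
    (h : ∀ w, w ≠ v → M v w = 0) :
    M.det = (M.submatrix (Subtype.val : ↥({v}ᶜ : Set V) → V) Subtype.val).det := by
  have : M.submatrix (Equiv.Set.sumCompl {v}) (Equiv.Set.sumCompl {v}) =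
      fromBlocks 1 0 (M.submatrix Subtype.val Subtype.val)
        (M.submatrix Subtype.val Subtype.val) := by
    ext (⟨a, rfl⟩ | ⟨a, ha⟩) (⟨b, rfl⟩ | ⟨b, hb⟩)
    · simpa using hv
    · simpa using h b hb
    · simp
    · simp
  rw [← det_submatrix_equiv_self (Equiv.Set.sumCompl {v}) M, this, det_fromBlocks_zero₁₂,
    det_one, one_mul]

/-- Expansion of a determinant along an index with a unit diagonal entry and exactly one
further entry in its row and in its column. -/
theorem det_leaf {M : Matrix V V R} {v u : V} (huv : u ∈ ({v}ᶜ : Set V)) (z : R)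
    (hv : M v v = 1) (hrow : ∀ w, w ≠ v → M v w = if w = u then z else 0)
    (hcol : ∀ w, w ≠ v → M w v = if w = u then z else 0) :
    M.det = (M.submatrix (Subtype.val : ↥({v}ᶜ : Set V) → V) Subtype.val).det -
      z ^ 2 * ((M.submatrix (Subtype.val : ↥({v}ᶜ : Set V) → V) Subtype.val).submatrix
        (Subtype.val : ↥({⟨u, huv⟩}ᶜ : Set ↥({v}ᶜ : Set V)) → ↥({v}ᶜ : Set V))
        Subtype.val).det := by
  set u' : ↥({v}ᶜ : Set V) := ⟨u, huv⟩ with hu'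
  set D := M.submatrix (Subtype.val : ↥({v}ᶜ : Set V) → V) Subtype.val with hD
  have hM : M.submatrix (Equiv.Set.sumCompl {v}) (Equiv.Set.sumCompl {v}) =
      fromBlocks 1 (of fun _ j => if j = u' then z else 0)
        (of fun i _ => if i = u' then z else 0) D := by
    ext (⟨a, rfl⟩ | ⟨a, ha⟩) (⟨b, rfl⟩ | ⟨b, hb⟩)
    · simpa using hv
    · simpa [hu'] using hrow b hb
    · simpa [hu'] using hcol a ha
    · simp [hD]
  -- The Schur complement of the unit entry changes `D` only at `(u', u')`, by `-z²`. Writing this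
  -- as a row update lets linearity in that row split the determinant.
  have hS : D - (of fun i _ => if i = u' then z else 0 : Matrix _ ↥({v} : Set V) R) *
      (of fun _ j => if j = u' then z else 0 : Matrix ↥({v} : Set V) _ R) =
      D.updateRow u' (D.row u' + (-z ^ 2) • Pi.single u' 1) := by
    ext a b
    rw [sub_apply, mul_apply, Fintype.sum_unique, updateRow_apply]
    by_cases h1 : a = u'
    · by_cases h2 : b = u' <;> simp [h1, h2, sub_eq_add_neg, sq]
    · simp [h1]
  rw [← det_submatrix_equiv_self (Equiv.Set.sumCompl {v}) M, hM, det_fromBlocks_one₁₁, hS,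
    det_updateRow_add, det_updateRow_smul,
    det_eq_det_submatrix_compl_singleton (M := D.updateRow u' (Pi.single u' 1)) (v := u')
      (by simp) (fun w hw => by simp [hw]), neg_mul, ← sub_eq_add_neg]
  congr 1
  · exact congrArg det (updateRow_eq_self D u')
  · congr 2
    ext a b
    simp only [submatrix_apply]
    rw [updateRow_ne a.2]

end Matrix

/-! ### Matching sums of forests -/

namespace SimpleGraph

open Classical in
/-- The permanent of `1 + t A(G)`; for acyclic `G` this is the matching generating polynomial
of `G` evaluated at `t ^ 2`. -/
noncomputable def matchingSum {V : Type*} [Finite V] (G : SimpleGraph V) (t : ℝ) : ℝ :=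
  letI := Fintype.ofFinite V
  (1 + t • G.adjMatrix ℝ).permanent

universe u

variable {V W : Type*} [Finite V] [Finite W] {G : SimpleGraph V} {H : SimpleGraph W}

theorem IsAcyclic.ofReal_matchingSum {V : Type*} [Fintype V] [DecidableEq V] {G : SimpleGraph V}
    [DecidableRel G.Adj] (hG : G.IsAcyclic) (t : ℝ) :
    (G.matchingSum t : ℂ) = (1 + ((t : ℂ) * Complex.I) • G.adjMatrix ℂ).det := by
  have h1 : (G.matchingSum t : ℂ) = (1 + (t : ℂ) • G.adjMatrix ℂ).permanent := by
    simp only [matchingSum, Matrix.permanent, Complex.ofReal_sum, Complex.ofReal_prod]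
    refine Finset.sum_congr (by congr!) fun σ _ => Finset.prod_congr (by congr!) fun i _ => ?_
    by_cases h : σ i = i <;> by_cases h' : G.Adj (σ i) i <;>
      simp [adjMatrix_apply, h, h']
  rw [h1]
  refine hG.permanent_eq_det Complex.I_sq (fun v => by simp) (fun v w h => ?_) fun v w h h' => ?_
  · simp only [Matrix.add_apply, Matrix.smul_apply, Matrix.one_apply_ne h, smul_eq_mul]
    ring
  · simp [Matrix.one_apply_ne h, adjMatrix_apply, h']

theorem matchingSum_bot (t : ℝ) : (⊥ : SimpleGraph V).matchingSum t = 1 := by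
  classical
  have := Fintype.ofFinite V
  have h := (isAcyclic_bot (V := V)).ofReal_matchingSum t
  have h0 : (⊥ : SimpleGraph V).adjMatrix ℂ = 0 := by ext; simp [adjMatrix_apply]
  rw [h0, smul_zero, add_zero, Matrix.det_one] at h
  exact_mod_cast h

theorem matchingSum_of_subsingleton [Subsingleton V] (G : SimpleGraph V) (t : ℝ) :
    G.matchingSum t = 1 := by
  rw [Subsingleton.elim G ⊥, matchingSum_bot]

theorem IsAcyclic.matchingSum_congr (hG : G.IsAcyclic) (e : G ≃g H) (t : ℝ) :
    G.matchingSum t = H.matchingSum t := by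
  classical
  have := Fintype.ofFinite V
  have := Fintype.ofFinite W
  have hH : H.IsAcyclic := e.isAcyclic_iff.1 hG
  rw [← Complex.ofReal_inj, hG.ofReal_matchingSum, hH.ofReal_matchingSum,
    ← Matrix.det_submatrix_equiv_self e.toEquiv]
  congr 1
  ext a b
  have : H.Adj (e a) (e b) ↔ G.Adj a b := e.map_adj_iff
  simp [Matrix.one_apply, adjMatrix_apply, this]

theorem submatrix_one_add_smul_adjMatrix {V : Type*} [DecidableEq V] (G : SimpleGraph V)
    [DecidableRel G.Adj] (z : ℂ) (s : Set V) [DecidableRel (G.induce s).Adj] :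
    (1 + z • G.adjMatrix ℂ).submatrix (Subtype.val : s → V) Subtype.val =
      1 + z • (G.induce s).adjMatrix ℂ := by
  ext a b
  simp [Matrix.one_apply, adjMatrix_apply, Subtype.ext_iff]

theorem IsAcyclic.matchingSum_isolated (hG : G.IsAcyclic) {v : V} (h : ∀ w, ¬ G.Adj v w) (t : ℝ) :
    G.matchingSum t = (G.induce {v}ᶜ).matchingSum t := by
  classical
  have := Fintype.ofFinite V
  rw [← Complex.ofReal_inj, hG.ofReal_matchingSum, (hG.induce _).ofReal_matchingSum,
    Matrix.det_eq_det_submatrix_compl_singleton (v := v) (by simp)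
      (fun w hw => by simp [hw.symm, adjMatrix_apply, h]), submatrix_one_add_smul_adjMatrix]

/-- A matching either misses `v` or uses the edge `uv`. In the determinant expansion the entry is `z
= it`, so `-z² = t²`. -/
theorem IsAcyclic.matchingSum_leaf (hG : G.IsAcyclic) {v u : V} (h : ∀ w, G.Adj v w ↔ w = u)
    (hu : u ∈ ({v}ᶜ : Set V)) (t : ℝ) :
    G.matchingSum t = (G.induce {v}ᶜ).matchingSum t +
      t ^ 2 * ((G.induce {v}ᶜ).induce {⟨u, hu⟩}ᶜ).matchingSum t := by
  classical
  have := Fintype.ofFinite V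
  have key := Matrix.det_leaf (M := 1 + ((t : ℂ) * Complex.I) • G.adjMatrix ℂ) hu
    ((t : ℂ) * Complex.I) (by simp) (fun w hw => by simp [hw.symm, adjMatrix_apply, h])
    (fun w hw => by simp [hw, adjMatrix_apply, G.adj_comm w v, h])
  rw [submatrix_one_add_smul_adjMatrix, submatrix_one_add_smul_adjMatrix] at key
  rw [← Complex.ofReal_inj]
  push_cast
  rw [hG.ofReal_matchingSum, (hG.induce _).ofReal_matchingSum,
    ((hG.induce _).induce _).ofReal_matchingSum, key, mul_pow, Complex.I_sq]
  ring

theorem mem_compl_singleton_of_leaf {V : Type*} {G : SimpleGraph V} {v u : V}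
    (h : ∀ w, G.Adj v w ↔ w = u) : u ∈ ({v}ᶜ : Set V) :=
  ((h u).2 rfl).ne'

theorem natCard_compl_singleton {V : Type*} [Finite V] {n : ℕ} (h : Nat.card V = n + 1) (v : V) :
    Nat.card ↥({v}ᶜ : Set V) = n := by
  rw [Nat.card_coe_set_eq, Set.ncard_compl, Set.ncard_singleton, h, Nat.add_sub_cancel]

/-- The matching sum of a forest is at least `1`, and exceeds `1` as soon as there is an edge. -/
theorem IsAcyclic.one_le_matchingSum_and {t : ℝ} (ht : 0 < t) (n : ℕ) :
    ∀ {V : Type u} [Finite V] {G : SimpleGraph V}, G.IsAcyclic → Nat.card V = n →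
      1 ≤ G.matchingSum t ∧ (G.matchingSum t = 1 → G = ⊥) := by
  induction n using Nat.strong_induction_on with
  | _ n ih =>
    intro V _ G hG hn
    rcases isEmpty_or_nonempty V with hV | hV
    · rw [matchingSum_of_subsingleton]
      exact ⟨le_rfl, fun _ => Subsingleton.elim _ _⟩
    obtain ⟨n, rfl⟩ : ∃ m, n = m + 1 := Nat.exists_eq_add_one.2 (hn ▸ Nat.card_pos)
    obtain ⟨v, hv | ⟨u, hv⟩⟩ := hG.exists_isolated_or_leaf
    · rw [hG.matchingSum_isolated hv]
      have := ih n (by lia) (hG.induce {v}ᶜ) (natCard_compl_singleton hn v)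
      refine ⟨this.1, fun h => ?_⟩
      have hbot := this.2 h
      ext a b
      simp only [bot_adj, iff_false]
      intro hab
      have ha : a ≠ v := fun h => hv b (h ▸ hab)
      have hb : b ≠ v := fun h => hv a (h ▸ hab.symm)
      have : (G.induce {v}ᶜ).Adj ⟨a, ha⟩ ⟨b, hb⟩ := hab
      rw [hbot] at this
      exact this
    · have hu := mem_compl_singleton_of_leaf hv
      rw [hG.matchingSum_leaf hv hu]
      have h1 := (ih n (by lia) (hG.induce {v}ᶜ) (natCard_compl_singleton hn v)).1
      have hc := natCard_compl_singleton hn v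
      obtain ⟨m, rfl⟩ : ∃ m, n = m + 1 :=
        Nat.exists_eq_add_one.2 (hc ▸ (Nat.card_pos_iff.2 ⟨⟨⟨u, hu⟩⟩, inferInstance⟩))
      have h2 := (ih m (by lia) ((hG.induce {v}ᶜ).induce {⟨u, hu⟩}ᶜ)
        (natCard_compl_singleton hc _)).1
      have h3 : 0 < t ^ 2 * ((G.induce {v}ᶜ).induce {⟨u, hu⟩}ᶜ).matchingSum t := by positivity
      exact ⟨by linarith, fun h => by linarith⟩

theorem IsAcyclic.one_le_matchingSum (hG : G.IsAcyclic) {t : ℝ} (ht : 0 < t) :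
    1 ≤ G.matchingSum t :=
  (IsAcyclic.one_le_matchingSum_and ht _ hG rfl).1

theorem IsAcyclic.eq_bot_of_matchingSum_eq_one (hG : G.IsAcyclic) {t : ℝ} (ht : 0 < t)
    (h : G.matchingSum t = 1) : G = ⊥ :=
  (IsAcyclic.one_le_matchingSum_and ht _ hG rfl).2 h

/-! ### Paths -/

/-- Every edge is a bridge: a walk from `i` to `i + 1` must leave `{k | k ≤ i}`, and only the edge
between them does so. -/
theorem isAcyclic_pathGraph (n : ℕ) : (pathGraph n).IsAcyclic := by
  have key : ∀ i j : Fin n, i.val + 1 = j.val → (pathGraph n).IsBridge s(i, j) := by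
    intro i j hij
    rw [isBridge_iff]
    rintro ⟨p⟩
    obtain ⟨d, -, h1, h2⟩ := p.exists_boundary_dart {k | k ≤ i} (le_refl i)
      (by simp only [Set.mem_ofPred_eq, Fin.le_def]; lia)
    have h3 := d.adj
    simp only [Set.mem_ofPred_eq, not_le, Fin.le_def] at h1 h2
    rw [deleteEdges_adj, pathGraph_adj] at h3
    refine h3.2 ?_
    rw [Set.mem_singleton_iff, show d.fst = i from Fin.ext (by lia),
      show d.snd = j from Fin.ext (by lia)]
  rw [isAcyclic_iff_forall_adj_isBridge]
  intro i j h
  rcases pathGraph_adj.1 h with h | h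
  · exact key i j h
  · rw [Sym2.eq_swap]
    exact key j i h

/-- Deleting the last vertex of a path leaves a path. -/
def pathGraphInduceLast (n : ℕ) : (pathGraph (n + 1)).induce {Fin.last n}ᶜ ≃g pathGraph n where
  toFun i := ⟨i.1, Fin.val_lt_last i.2⟩
  invFun i := ⟨i.castSucc, Fin.castSucc_ne_last i⟩
  left_inv i := by ext; rfl
  right_inv i := by ext; rfl
  map_rel_iff' {a b} := by simp [pathGraph_adj]

/-- The reversal of a path. -/
def pathGraphRev (n : ℕ) : pathGraph n ≃g pathGraph n where
  toEquiv := Fin.revPerm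
  map_rel_iff' {a b} := by
    simp only [pathGraph_adj, Fin.revPerm_apply, Fin.val_rev]
    lia

/-- An isomorphism restricts to the complements of corresponding vertices. -/
def Iso.induceComplSingleton {V W : Type*} {G : SimpleGraph V} {H : SimpleGraph W} (e : G ≃g H)
    {v : V} {w : W} (h : e v = w) : G.induce {v}ᶜ ≃g H.induce {w}ᶜ where
  toEquiv := e.toEquiv.subtypeEquiv fun a => by
    subst h
    simp
  map_rel_iff' {a b} := e.map_adj_iff

theorem pathGraph_last_adj (n : ℕ) (w : Fin (n + 2)) :
    (pathGraph (n + 2)).Adj (Fin.last (n + 1)) w ↔ w = (Fin.last n).castSucc := by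
  rw [pathGraph_adj, Fin.ext_iff]
  simp only [Fin.val_last, Fin.val_castSucc]
  lia

theorem matchingSum_pathGraph_add_two (n : ℕ) (t : ℝ) :
    (pathGraph (n + 2)).matchingSum t =
      (pathGraph (n + 1)).matchingSum t + t ^ 2 * (pathGraph n).matchingSum t := by
  have hG := isAcyclic_pathGraph (n + 2)
  have hu := mem_compl_singleton_of_leaf (pathGraph_last_adj n)
  rw [hG.matchingSum_leaf (pathGraph_last_adj n) hu,
    (hG.induce _).matchingSum_congr (pathGraphInduceLast (n + 1)),
    ((hG.induce _).induce _).matchingSum_congr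
      (((pathGraphInduceLast (n + 1)).induceComplSingleton rfl).trans (pathGraphInduceLast n))]

/-- A walk between the two ends avoiding an interior vertex would have to jump over it. In the
equality case for paths this locates the neighbour of the deleted leaf. -/
theorem eq_zero_or_last_of_preconnected {n : ℕ} {i : Fin (n + 1)}
    (h : ((pathGraph (n + 1)).induce {i}ᶜ).Preconnected) : i = 0 ∨ i = Fin.last n := by
  by_contra! hi
  obtain ⟨p⟩ := h ⟨0, hi.1.symm⟩ ⟨Fin.last n, hi.2.symm⟩
  obtain ⟨d, -, h1, h2⟩ := p.exists_boundary_dart {k | k.1 < i} (Fin.pos_iff_ne_zero.2 hi.1)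
    (fun h : Fin.last n < i => (Fin.le_last i).not_gt h)
  have h3 : (pathGraph (n + 1)).Adj d.fst.1 d.snd.1 := d.adj
  have h4 : d.snd.1 ≠ i := d.snd.2
  rw [pathGraph_adj] at h3
  simp only [Set.mem_ofPred_eq, Fin.lt_def] at h1 h2
  have := Fin.val_ne_of_ne h4
  lia

/-- Attaching leaves at corresponding vertices of isomorphic graphs gives isomorphic graphs. -/
theorem nonempty_iso_of_leaf {V W : Type*} {G : SimpleGraph V} {H : SimpleGraph W} {v u : V}
    {v' u' : W} (h : ∀ w, G.Adj v w ↔ w = u) (h' : ∀ w, H.Adj v' w ↔ w = u')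
    (hu : u ∈ ({v}ᶜ : Set V)) (hu' : u' ∈ ({v'}ᶜ : Set W))
    (e : G.induce {v}ᶜ ≃g H.induce {v'}ᶜ) (he : e ⟨u, hu⟩ = ⟨u', hu'⟩) : Nonempty (G ≃g H) := by
  classical
  let F : V ≃ W := ((Equiv.Set.sumCompl {v}).symm.trans
    (Equiv.sumCongr (Equiv.ofUnique _ _) e.toEquiv)).trans (Equiv.Set.sumCompl {v'})
  have hFv : F v = v' := by simp [F, Equiv.Set.sumCompl_symm_apply_of_mem (Set.mem_singleton v)]
  have hF : ∀ x (hx : x ∈ ({v}ᶜ : Set V)), F x = (e ⟨x, hx⟩).1 := fun x hx => by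
    simp only [F, Equiv.trans_apply, Equiv.Set.sumCompl_symm_apply_of_notMem hx]
    rfl
  have hFu : ∀ w, F w = u' ↔ w = u := fun w => by
    rw [show u' = F u by rw [hF u hu, he], F.apply_eq_iff_eq]
  refine ⟨⟨F, fun {a b} => ?_⟩⟩
  by_cases ha : a = v
  · rw [ha, hFv, h, h', hFu]
  by_cases hb : b = v
  · rw [hb, hFv, G.adj_comm, H.adj_comm, h, h', hFu]
  rw [hF a ha, hF b hb]
  exact e.map_adj_iff (v := ⟨a, ha⟩) (w := ⟨b, hb⟩)

/-- The leaf recursion is compared term by term with the path recursion. Equality makes both `G-v`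
and `G-v-u` paths; the latter is connected, so `u` is an end of `G-v`, and reattaching `v` gives a
path. -/
theorem IsAcyclic.matchingSum_le_pathGraph_and {t : ℝ} (ht : 0 < t) (n : ℕ) :
    ∀ {V : Type u} [Finite V] {G : SimpleGraph V}, G.IsAcyclic → Nat.card V = n →
      G.matchingSum t ≤ (pathGraph n).matchingSum t ∧
        (G.matchingSum t = (pathGraph n).matchingSum t → Nonempty (G ≃g pathGraph n)) := by
  induction n using Nat.strong_induction_on with
  | _ n ih =>
    intro V _ G hG hn
    by_cases hn' : n ≤ 1
    · have : Subsingleton V := (Finite.card_le_one_iff_subsingleton (α := V)).1 (by lia)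
      have : Subsingleton (Fin n) := Fin.subsingleton_iff_le_one.2 hn'
      simp only [matchingSum_of_subsingleton, le_refl, true_and]
      exact fun _ => ⟨⟨Finite.equivFinOfCardEq hn, fun {a b} => by simp [Subsingleton.elim a b]⟩⟩
    obtain ⟨n, rfl⟩ : ∃ m, n = m + 2 := ⟨n - 2, by lia⟩
    have : Nonempty V := (Nat.card_pos_iff.1 (by lia)).1
    rw [matchingSum_pathGraph_add_two]
    have hP := mul_pos (pow_pos ht 2)
      (one_pos.trans_le ((isAcyclic_pathGraph n).one_le_matchingSum ht))
    obtain ⟨v, hv | ⟨u, hv⟩⟩ := hG.exists_isolated_or_leaf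
    all_goals
      have hc := natCard_compl_singleton hn v
      have h1 := ih (n + 1) (by lia) (hG.induce {v}ᶜ) hc
    -- With an isolated vertex the positive term `t² M` of the path recursion is missing, so
    -- equality cannot occur.
    · rw [hG.matchingSum_isolated hv]
      exact ⟨by linarith [h1.1], fun h => by linarith [h1.1]⟩
    · have hu := mem_compl_singleton_of_leaf hv
      rw [hG.matchingSum_leaf hv hu]
      have h2 := ih n (by lia) ((hG.induce {v}ᶜ).induce {⟨u, hu⟩}ᶜ) (natCard_compl_singleton hc _)
      have h3 := mul_le_mul_of_nonneg_left h2.1 (pow_pos ht 2).le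
      refine ⟨add_le_add h1.1 h3, fun h => ?_⟩
      obtain ⟨e⟩ := h1.2 (by linarith [h1.1])
      obtain ⟨e'⟩ := h2.2 (mul_left_cancel₀ (pow_pos ht 2).ne' (by linarith [h1.1]))
      -- Reversing the path if necessary, `u` may be taken to be its last vertex.
      obtain ⟨e, he⟩ : ∃ e : G.induce {v}ᶜ ≃g pathGraph (n + 1), e ⟨u, hu⟩ = Fin.last n := by
        have hpre : ((pathGraph (n + 1)).induce {e ⟨u, hu⟩}ᶜ).Preconnected :=
          let f : pathGraph n ≃g _ := e'.symm.trans (e.induceComplSingleton rfl)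
          (pathGraph_preconnected n).map (Iso.toHom f) f.surjective
        rcases eq_zero_or_last_of_preconnected hpre with h | h
        · exact ⟨e.trans (pathGraphRev _), by
            change Fin.rev (e ⟨u, hu⟩) = _
            rw [h, Fin.rev_zero]⟩
        · exact ⟨e, h⟩
      refine nonempty_iso_of_leaf hv (pathGraph_last_adj n) hu
        (mem_compl_singleton_of_leaf (pathGraph_last_adj n))
        (e.trans (pathGraphInduceLast (n + 1)).symm) ?_
      change (pathGraphInduceLast (n + 1)).symm (e ⟨u, hu⟩) = _
      rw [he]
      rfl

/-! ### Stars -/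

theorem matchingSum_starGraph (n : ℕ) (t : ℝ) :
    ∀ {V : Type u} [Finite V] (r : V), Nat.card V = n + 1 →
      (starGraph r).matchingSum t = 1 + n * t ^ 2 := by
  induction n with
  | zero =>
    intro V _ r hn
    have : Subsingleton V := (Finite.card_le_one_iff_subsingleton (α := V)).1 (by lia)
    simp [matchingSum_of_subsingleton]
  | succ n ih =>
    intro V _ r hn
    have : Nontrivial V := Finite.one_lt_card_iff_nontrivial.1 (by lia)
    obtain ⟨v, hv⟩ := exists_ne r
    have h : ∀ w, (starGraph r).Adj v w ↔ w = r := fun w => by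
      rw [starGraph_adj]
      grind
    have hr := mem_compl_singleton_of_leaf h
    have h1 : (starGraph r).induce {v}ᶜ = starGraph ⟨r, hr⟩ := by
      ext a b
      simp [Subtype.ext_iff]
    have h2 : (starGraph (⟨r, hr⟩ : ↥({v}ᶜ : Set V))).induce {⟨r, hr⟩}ᶜ = ⊥ := by
      ext a b
      have ha : a.1 ≠ ⟨r, hr⟩ := a.2
      have hb : b.1 ≠ ⟨r, hr⟩ := b.2
      simp only [comap_adj, starGraph_adj, Function.Embedding.subtype_apply, ha, hb, bot_adj]
      simp
    rw [(isAcyclic_starGraph r).matchingSum_leaf h hr, h1, h2, matchingSum_bot,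
      ih _ (natCard_compl_singleton hn v)]
    push_cast
    ring

/-- Deleting a leaf leaves a tree, and the other term of the recursion is at least `t²`. Equality
makes `G-v-u` edgeless, so every edge meets `u`, and connectedness joins every other vertex to `u`.
-/
theorem IsTree.le_matchingSum_and {t : ℝ} (ht : 0 < t) (n : ℕ) :
    ∀ {V : Type u} [Finite V] {G : SimpleGraph V}, G.IsTree → Nat.card V = n + 1 →
      1 + n * t ^ 2 ≤ G.matchingSum t ∧
        (G.matchingSum t = 1 + n * t ^ 2 → ∃ r, G = starGraph r) := by
  induction n with
  | zero =>
    intro V _ G hG hn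
    have : Subsingleton V := (Finite.card_le_one_iff_subsingleton (α := V)).1 (by lia)
    obtain ⟨r⟩ := hG.connected.nonempty
    exact ⟨by simp [matchingSum_of_subsingleton], fun _ => ⟨r, Subsingleton.elim _ _⟩⟩
  | succ n ih =>
    intro V _ G hG hn
    classical
    have := Fintype.ofFinite V
    have : Nontrivial V := Finite.one_lt_card_iff_nontrivial.1 (by lia)
    obtain ⟨v, hdeg⟩ := hG.exists_vert_degree_one_of_nontrivial
    obtain ⟨u, hvu, huniq⟩ := degree_eq_one_iff_existsUnique_adj.mp hdeg
    have hv : ∀ w, G.Adj v w ↔ w = u := fun w => ⟨huniq w, fun h => h ▸ hvu⟩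
    have hu := mem_compl_singleton_of_leaf hv
    have h1 := ih ⟨hG.connected.induce_compl_singleton_of_degree_eq_one hdeg,
      hG.isAcyclic.induce _⟩ (natCard_compl_singleton hn v)
    have hac := (hG.isAcyclic.induce {v}ᶜ).induce {⟨u, hu⟩}ᶜ
    have h2 := mul_le_mul_of_nonneg_left (hac.one_le_matchingSum ht) (pow_pos ht 2).le
    rw [hG.isAcyclic.matchingSum_leaf hv hu]
    push_cast
    refine ⟨by linarith [h1.1], fun h => ⟨u, ?_⟩⟩
    have hbot := hac.eq_bot_of_matchingSum_eq_one ht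
      (mul_left_cancel₀ (pow_pos ht 2).ne' (by linarith [h1.1]))
    have hedge : ∀ a b, G.Adj a b → a = u ∨ b = u := by
      intro a b hab
      by_contra! hne
      have ha : a ≠ v := fun h => hne.2 (huniq b (h ▸ hab))
      have hb : b ≠ v := fun h => hne.1 (huniq a (h ▸ hab.symm))
      have : ((G.induce {v}ᶜ).induce {⟨u, hu⟩}ᶜ).Adj
          ⟨⟨a, ha⟩, fun h => hne.1 (congrArg Subtype.val h)⟩
          ⟨⟨b, hb⟩, fun h => hne.2 (congrArg Subtype.val h)⟩ := hab
      rw [hbot] at this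
      exact this
    have hcenter : ∀ b, b ≠ u → G.Adj u b := fun b hb => by
      obtain ⟨c, hc⟩ := hG.connected.preconnected.exists_adj_of_nontrivial b
      rcases hedge b c hc with h | h
      · exact absurd h hb
      · exact h ▸ hc.symm
    ext a b
    rw [starGraph_adj]
    refine ⟨fun h => ⟨h.ne, hedge a b h⟩, ?_⟩
    rintro ⟨hab, rfl | rfl⟩
    · exact hcenter b hab.symm
    · exact (hcenter a hab).symm

/-- A star with `n` leaves is the complete bipartite graph `K_{1,n}`. -/
theorem nonempty_starGraph_iso_completeBipartiteGraph {n : ℕ} (hn : Nat.card V = n + 1) (r : V) :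
    Nonempty (starGraph r ≃g completeBipartiteGraph (Fin 1) (Fin n)) := by
  classical
  have e : ↥({r}ᶜ : Set V) ≃ Fin n := Finite.equivFinOfCardEq (natCard_compl_singleton hn r)
  let F : V ≃ Fin 1 ⊕ Fin n :=
    (Equiv.Set.sumCompl {r}).symm.trans (Equiv.sumCongr (Equiv.ofUnique _ _) e)
  have h1 : ∀ x, x = r ↔ (F x).isLeft := fun x => by
    by_cases hx : x = r
    · simp [F, hx, Equiv.Set.sumCompl_symm_apply_of_mem (Set.mem_singleton r)]
    · simp [F, hx, Equiv.Set.sumCompl_symm_apply_of_notMem (show x ∉ ({r} : Set V) from hx)]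
  refine ⟨⟨F, fun {a b} => ?_⟩⟩
  rw [starGraph_adj, completeBipartiteGraph_adj, ← F.injective.ne_iff, h1, h1]
  rcases F a with i | i <;> rcases F b with j | j <;> simp
  exact Subsingleton.elim i j

end SimpleGraph

/-! ### The Coulson-type integral -/

open MeasureTheory Set

/-- The normalizing constant of the Coulson-type integral `∫ log (1 + (tx)²) / t² dt`. -/
noncomputable def coulsonConst : ℝ := ∫ t in Ioi (0 : ℝ), Real.log (1 + t ^ 2) / t ^ 2

theorem setIntegral_Ioi_pos {f : ℝ → ℝ} (hf : IntegrableOn f (Ioi 0)) (h : ∀ t, 0 < t → 0 < f t) :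
    0 < ∫ t in Ioi (0 : ℝ), f t := by
  rw [setIntegral_pos_iff_support_of_nonneg_ae
    ((ae_restrict_iff' measurableSet_Ioi).2 (.of_forall fun t ht => (h t ht).le)) hf]
  have : Function.support f ∩ Ioi 0 = Ioi 0 := inter_eq_right.2 fun t ht => (h t ht).ne'
  simp [this]

/-- Any exponent below `1` on the right would do: after division by `t²`, the exponent `1/2` leaves
the integrable tail `t^(-3/2)`. -/
theorem log_one_add_sq_le {t : ℝ} (ht : 0 ≤ t) : Real.log (1 + t ^ 2) ≤ 4 * t ^ (1 / 2 : ℝ) := by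
  rw [← Real.sqrt_eq_rpow]
  have hs := Real.sqrt_nonneg t
  have h1 : 1 + t ^ 2 ≤ (1 + √t) ^ 4 := by
    nth_rw 1 [← Real.sq_sqrt ht]
    nlinarith [pow_nonneg hs 2, pow_nonneg hs 3]
  calc Real.log (1 + t ^ 2) ≤ Real.log ((1 + √t) ^ 4) := Real.log_le_log (by positivity) h1
    _ = 4 * Real.log (1 + √t) := by rw [Real.log_pow]; norm_num
    _ ≤ 4 * √t := by linarith [Real.log_le_sub_one_of_pos (show 0 < 1 + √t by positivity)]

theorem integrableOn_log_one_add_sq_div_sq :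
    IntegrableOn (fun t : ℝ => Real.log (1 + t ^ 2) / t ^ 2) (Ioi 0) := by
  have hm : Measurable fun t : ℝ => Real.log (1 + t ^ 2) / t ^ 2 := by fun_prop
  have hnn : ∀ t : ℝ, 0 ≤ Real.log (1 + t ^ 2) / t ^ 2 := fun t =>
    div_nonneg (Real.log_nonneg (by nlinarith)) (sq_nonneg t)
  rw [← Ioc_union_Ioi_eq_Ioi zero_le_one]
  refine IntegrableOn.union ?_ ?_
  · refine Measure.integrableOn_of_bounded (M := 1) (by simp) hm.aestronglyMeasurable ?_
    refine .of_forall fun t => ?_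
    rw [Real.norm_of_nonneg (hnn t)]
    have := Real.log_le_sub_one_of_pos (show 0 < 1 + t ^ 2 by positivity)
    exact div_le_one_of_le₀ (by linarith) (sq_nonneg t)
  · have hint := (integrableOn_Ioi_rpow_of_lt (show (-3 / 2 : ℝ) < -1 by norm_num)
      one_pos).const_mul 4
    refine Integrable.mono' hint hm.aestronglyMeasurable ?_
    refine (ae_restrict_iff' measurableSet_Ioi).2 (.of_forall fun t (ht : 1 < t) => ?_)
    have h0 : 0 < t := by linarith
    rw [Real.norm_of_nonneg (hnn t), div_le_iff₀ (by positivity), mul_assoc, ← Real.rpow_two t,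
      ← Real.rpow_add h0, Real.rpow_two, show (-3 / 2 + 2 : ℝ) = 1 / 2 by norm_num]
    exact log_one_add_sq_le h0.le

theorem coulsonConst_pos : 0 < coulsonConst :=
  setIntegral_Ioi_pos integrableOn_log_one_add_sq_div_sq fun t ht =>
    div_pos (Real.log_pos (by nlinarith)) (by positivity)

theorem log_one_add_mul_sq_div_sq (x t : ℝ) (hx : x ≠ 0) :
    Real.log (1 + (t * x) ^ 2) / t ^ 2 =
      |x| ^ 2 * (Real.log (1 + (|x| * t) ^ 2) / (|x| * t) ^ 2) := by
  rw [mul_comm t x, mul_pow |x|, mul_pow x, sq_abs, ← mul_div_assoc,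
    mul_div_mul_left _ _ (pow_ne_zero 2 hx)]

theorem integrableOn_log_one_add_mul_sq_div_sq (x : ℝ) :
    IntegrableOn (fun t : ℝ => Real.log (1 + (t * x) ^ 2) / t ^ 2) (Ioi 0) := by
  rcases eq_or_ne x 0 with rfl | hx
  · simp
  · simp_rw [log_one_add_mul_sq_div_sq x _ hx]
    refine Integrable.const_mul ?_ _
    have := integrableOn_Ioi_comp_mul_left_iff (fun t : ℝ => Real.log (1 + t ^ 2) / t ^ 2) 0
      (abs_pos.2 hx)
    rw [mul_zero] at this
    exact this.2 integrableOn_log_one_add_sq_div_sq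

/-- The substitution `s = |x| t` gives a factor `|x|² / |x|`. -/
theorem integral_log_one_add_mul_sq_div_sq (x : ℝ) :
    ∫ t in Ioi (0 : ℝ), Real.log (1 + (t * x) ^ 2) / t ^ 2 = coulsonConst * |x| := by
  rcases eq_or_ne x 0 with rfl | hx
  · simp
  · simp_rw [log_one_add_mul_sq_div_sq x _ hx]
    rw [integral_const_mul, integral_comp_mul_left_Ioi
      (fun t : ℝ => Real.log (1 + t ^ 2) / t ^ 2) 0 (abs_pos.2 hx), mul_zero, smul_eq_mul,
      coulsonConst]
    field_simp [abs_ne_zero.2 hx]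

/-! ### Spectral formulas for complex multiples of a Hermitian matrix -/

namespace Matrix.IsHermitian

open Polynomial

variable {n : Type*} [Fintype n] [DecidableEq n] {A : Matrix n n ℂ}

theorem charpoly_smul_eq (hA : A.IsHermitian) (z : ℂ) :
    (z • A).charpoly = ∏ i, (X - C (z * hA.eigenvalues i)) := by
  conv_lhs => rw [hA.spectral_theorem, Unitary.conjStarAlgAut_apply, ← smul_mul_assoc,
    charpoly_mul_comm, mul_smul_comm, ← mul_assoc]
  simp [← diagonal_smul, charpoly_diagonal]

theorem det_one_add_smul_eq (hA : A.IsHermitian) (z : ℂ) :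
    (1 + z • A).det = ∏ i, (1 + z * hA.eigenvalues i) := by
  conv_lhs => rw [hA.spectral_theorem, Unitary.conjStarAlgAut_apply, ← smul_mul_assoc,
    det_one_add_mul_comm, mul_smul_comm, ← mul_assoc]
  simp only [Unitary.coe_star_mul_self, one_mul]
  rw [← diagonal_smul, ← diagonal_one, diagonal_add, det_diagonal]
  simp

end Matrix.IsHermitian

/-! ### Energy through matching sums -/

namespace SimpleGraph

open Polynomial

variable {V W : Type*} [Fintype V] [Fintype W] {G : SimpleGraph V} {H : SimpleGraph W}

open Classical in
theorem IsAcyclic.permanentalPoly_eq_charpoly (hG : G.IsAcyclic) :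
    G.permanentalPoly = (Complex.I • G.adjMatrix ℂ).charpoly := by
  refine hG.permanent_eq_det (ζ := C Complex.I) (by rw [← C_pow, Complex.I_sq]; simp)
    (fun v => by simp [Matrix.charmatrix_apply_eq]) (fun v w h => ?_) fun v w h h' => ?_
  · simp [Matrix.charmatrix_apply_ne _ _ _ h, adjMatrix_apply, apply_ite]
  · simp [Matrix.charmatrix_apply_ne _ _ _ h, adjMatrix_apply, h']

open Classical in
theorem IsAcyclic.permanentalEnergy_eq (hG : G.IsAcyclic) :
    G.permanentalEnergy = ∑ v, |(G.isHermitian_adjMatrix ℂ).eigenvalues v| := by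
  rw [permanentalEnergy, hG.permanentalPoly_eq_charpoly, (G.isHermitian_adjMatrix ℂ).charpoly_smul_eq,
    roots_prod _ _ (Finset.prod_ne_zero_iff.2 fun i _ => X_sub_C_ne_zero _)]
  simp only [roots_X_sub_C, Multiset.bind_singleton, Multiset.map_map]
  simp

open Classical in
theorem IsAcyclic.log_matchingSum (hG : G.IsAcyclic) (t : ℝ) :
    Real.log (G.matchingSum t) =
      2⁻¹ * ∑ v, Real.log (1 + (t * (G.isHermitian_adjMatrix ℂ).eigenvalues v) ^ 2) := by
  have h := hG.ofReal_matchingSum t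
  rw [(G.isHermitian_adjMatrix ℂ).det_one_add_smul_eq] at h
  -- Since the matching sum is real, taking squared moduli gives its square as a product of real
  -- factors, with no need to pair `λ` with `-λ`.
  have h2 := congrArg Complex.normSq h
  rw [Complex.normSq_ofReal, map_prod] at h2
  have h3 : ∀ x : ℝ, Complex.normSq (1 + t * Complex.I * x) = 1 + (t * x) ^ 2 := fun x => by
    simp [Complex.normSq_apply]
    ring
  simp only [h3] at h2
  rw [← Real.log_prod (fun v _ => by positivity), ← h2, ← sq, Real.log_pow]
  push_cast
  ring

/-- A Coulson-type integral formula for the permanental energy of a forest. -/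
theorem IsAcyclic.integrableOn_and_integral (hG : G.IsAcyclic) :
    IntegrableOn (fun t => Real.log (G.matchingSum t) / t ^ 2) (Ioi 0) ∧
      ∫ t in Ioi (0 : ℝ), Real.log (G.matchingSum t) / t ^ 2 =
        2⁻¹ * coulsonConst * G.permanentalEnergy := by
  classical
  have heq : EqOn (fun t => Real.log (G.matchingSum t) / t ^ 2) (fun t => 2⁻¹ * ∑ v,
      Real.log (1 + (t * (G.isHermitian_adjMatrix ℂ).eigenvalues v) ^ 2) / t ^ 2) (Ioi 0) :=
    fun t _ => by
      simp only
      rw [hG.log_matchingSum t, mul_div_assoc, Finset.sum_div]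
  have hint := fun v => integrableOn_log_one_add_mul_sq_div_sq ((G.isHermitian_adjMatrix ℂ).eigenvalues v)
  refine ⟨(integrableOn_congr_fun heq measurableSet_Ioi).2
    (Integrable.const_mul (integrable_finsetSum _ fun v _ => hint v) _), ?_⟩
  rw [setIntegral_congr_fun measurableSet_Ioi heq, integral_const_mul,
    integral_finsetSum _ fun v _ => hint v]
  simp only [integral_log_one_add_mul_sq_div_sq]
  rw [← Finset.mul_sum, hG.permanentalEnergy_eq, mul_assoc]

theorem IsAcyclic.permanentalEnergy_le (hG : G.IsAcyclic) (hH : H.IsAcyclic)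
    (h : ∀ t, 0 < t → G.matchingSum t ≤ H.matchingSum t) :
    G.permanentalEnergy ≤ H.permanentalEnergy := by
  have h1 := setIntegral_mono_on hG.integrableOn_and_integral.1 hH.integrableOn_and_integral.1
    measurableSet_Ioi fun t (ht : 0 < t) => div_le_div_of_nonneg_right
      (Real.log_le_log (one_pos.trans_le (hG.one_le_matchingSum ht)) (h t ht)) (sq_nonneg t)
  rw [hG.integrableOn_and_integral.2, hH.integrableOn_and_integral.2] at h1
  exact le_of_mul_le_mul_left h1 (mul_pos (by norm_num) coulsonConst_pos)

theorem IsAcyclic.permanentalEnergy_lt (hG : G.IsAcyclic) (hH : H.IsAcyclic)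
    (h : ∀ t, 0 < t → G.matchingSum t < H.matchingSum t) :
    G.permanentalEnergy < H.permanentalEnergy := by
  have h1 := setIntegral_Ioi_pos
    (hH.integrableOn_and_integral.1.sub hG.integrableOn_and_integral.1) fun t ht => sub_pos.2
      (div_lt_div_of_pos_right (Real.log_lt_log (one_pos.trans_le (hG.one_le_matchingSum ht))
        (h t ht)) (pow_pos ht 2))
  rw [integral_sub' hH.integrableOn_and_integral.1 hG.integrableOn_and_integral.1,
    hG.integrableOn_and_integral.2, hH.integrableOn_and_integral.2, sub_pos] at h1
  exact lt_of_mul_lt_mul_left h1 (mul_pos (by norm_num) coulsonConst_pos).le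

/-- Invariance follows from comparing equal matching sums in both directions. -/
theorem IsAcyclic.permanentalEnergy_congr (hG : G.IsAcyclic) (e : G ≃g H) :
    G.permanentalEnergy = H.permanentalEnergy := by
  have hH := e.isAcyclic_iff.1 hG
  exact le_antisymm
    (hG.permanentalEnergy_le hH fun t _ => (hG.matchingSum_congr e t).le)
    (hH.permanentalEnergy_le hG fun t _ => (hG.matchingSum_congr e t).ge)

/-- Permanental energies of comparable forests agree only if the matching sums agree at some
positive argument. -/
theorem IsAcyclic.exists_matchingSum_eq (hG : G.IsAcyclic) (hH : H.IsAcyclic)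
    (h : ∀ t, 0 < t → G.matchingSum t ≤ H.matchingSum t)
    (heq : G.permanentalEnergy = H.permanentalEnergy) :
    ∃ t, 0 < t ∧ G.matchingSum t = H.matchingSum t := by
  by_contra! hne
  exact (hG.permanentalEnergy_lt hH fun t ht => (h t ht).lt_of_ne (hne t ht)).ne heq

end SimpleGraph

theorem corollary4p4 {V : Type*} [Fintype V] (n : ℕ) (hn : Fintype.card V = n)
    (T : SimpleGraph V) (hT : T.IsTree) :
    ((completeBipartiteGraph (Fin 1) (Fin (n - 1))).permanentalEnergy ≤ T.permanentalEnergy ∧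
      T.permanentalEnergy ≤ (SimpleGraph.pathGraph n).permanentalEnergy) ∧
    ((completeBipartiteGraph (Fin 1) (Fin (n - 1))).permanentalEnergy = T.permanentalEnergy ↔
      Nonempty (T ≃g completeBipartiteGraph (Fin 1) (Fin (n - 1)))) ∧
    (T.permanentalEnergy = (SimpleGraph.pathGraph n).permanentalEnergy ↔
      Nonempty (T ≃g SimpleGraph.pathGraph n)) := by
  have hne := hT.connected.nonempty
  -- A tree is nonempty, so the truncated subtraction `n - 1` is genuine.
  obtain ⟨m, rfl⟩ : ∃ m, n = m + 1 := Nat.exists_eq_add_one.2 (hn ▸ Fintype.card_pos)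
  rw [Nat.add_sub_cancel]
  have hc : Nat.card V = m + 1 := Nat.card_eq_fintype_card.trans hn
  have hTa := hT.isAcyclic
  have hPa := SimpleGraph.isAcyclic_pathGraph (m + 1)
  have hK : Nat.card (Fin 1 ⊕ Fin m) = m + 1 := by simp [add_comm]
  obtain ⟨e⟩ := SimpleGraph.nonempty_starGraph_iso_completeBipartiteGraph hK (.inl 0)
  have hKa := e.isAcyclic_iff.1 (SimpleGraph.isAcyclic_starGraph _)
  have hKm : ∀ t, (completeBipartiteGraph (Fin 1) (Fin m)).matchingSum t = 1 + m * t ^ 2 :=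
    fun t => by
      rw [← (SimpleGraph.isAcyclic_starGraph _).matchingSum_congr e,
        SimpleGraph.matchingSum_starGraph m t _ hK]
  have hP := fun t (ht : 0 < t) => SimpleGraph.IsAcyclic.matchingSum_le_pathGraph_and ht _ hTa hc
  have hS := fun t (ht : 0 < t) => SimpleGraph.IsTree.le_matchingSum_and ht _ hT hc
  have hS' : ∀ t, 0 < t →
      (completeBipartiteGraph (Fin 1) (Fin m)).matchingSum t ≤ T.matchingSum t :=
    fun t ht => (hKm t).trans_le (hS t ht).1
  refine ⟨⟨hKa.permanentalEnergy_le hTa hS',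
    hTa.permanentalEnergy_le hPa fun t ht => (hP t ht).1⟩, ⟨fun h => ?_, ?_⟩, ⟨fun h => ?_, ?_⟩⟩
  · obtain ⟨t, ht, h⟩ := hKa.exists_matchingSum_eq hTa hS' h
    obtain ⟨r, rfl⟩ := (hS t ht).2 (h.symm.trans (hKm t))
    exact SimpleGraph.nonempty_starGraph_iso_completeBipartiteGraph hc r
  · rintro ⟨e⟩
    exact (hTa.permanentalEnergy_congr e).symm
  · obtain ⟨t, ht, h⟩ := hTa.exists_matchingSum_eq hPa (fun t ht => (hP t ht).1) h
    exact (hP t ht).2 h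
  · rintro ⟨e⟩
    exact hTa.permanentalEnergy_congr e
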